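/- For every $n\ge 0$, let $t_n$ be the number of totally cyclic orientations of the complete graph $K_n$ on $n$ labeled vertices (orientations in which every arc belongs to a directed cycle); equivalently, $t_n$ is the number of strongly connected tournaments on $n$ labeled vertices. Let $s_n$ be the number of strongly connected fourientations of $K_n$ (a fourientation allows each edge to be traversed in both directions, in exactly one of the two directions, or not at all); equivalently, $s_n$ is the number of strongly connected simple digraphs on $n$ labeled vertices (no loops and no parallel arcs; pairs of opposite arcs are allowed). Here a digraph is strongly connected if every vertex can reach every vertex by a directed path. Then, as formal power series over $\mathbb{Q}$, $$\frac{1}{1-\sum_{n=1}^{\infty} 2^{\binom n2}\, t_n \frac{x^n}{n!}}=\exp\left(\sum_{n=1}^{\infty} s_n\frac{x^n}{n!}\right).$$ -/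

import Mathlib

namespace Fourientation

/-- In the digraph `D`, the vertex `u` can reach the vertex `v` by a (possibly empty) directed
path. -/
def CanReach {V : Type*} (D : Digraph V) (u v : V) : Prop :=
  Relation.ReflTransGen D.Adj u v

/-- A digraph is strongly connected if every vertex can reach every vertex. -/
def StronglyConnected {V : Type*} (D : Digraph V) : Prop :=
  ∀ u v : V, CanReach D u v

/-- A fourientation of a simple graph `G` allows each edge of `G` to be traversed in both
directions, in exactly one direction, or not at all. It is given by its digraph: the set of arcs
`(u, v)`, with `{u, v}` an edge of `G`, along which the edge can be traversed. -/
def IsFourientation {V : Type*} (G : SimpleGraph V) (D : Digraph V) : Prop :=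
  ∀ u v : V, D.Adj u v → G.Adj u v

/-- The edge `{u, v}` is 1-way, and can be traversed from `u` to `v` only. -/
def OneWay {V : Type*} (D : Digraph V) (u v : V) : Prop :=
  D.Adj u v ∧ ¬ D.Adj v u

/-- An orientation of `G` is a fourientation in which every edge of `G` is 1-way. -/
def IsOrientation {V : Type*} (G : SimpleGraph V) (D : Digraph V) : Prop :=
  IsFourientation G D ∧ ∀ u v : V, G.Adj u v → OneWay D u v ∨ OneWay D v u

/-- The arc `(u, v)` of `D` is cyclic if it belongs to a directed cycle, that is, if `v` can
reach `u`. -/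
def CyclicArc {V : Type*} (D : Digraph V) (u v : V) : Prop :=
  D.Adj u v ∧ CanReach D v u

/-- A fourientation is totally cyclic if all its 1-way edges are cyclic. -/
def TotallyCyclic {V : Type*} (D : Digraph V) : Prop :=
  ∀ u v : V, OneWay D u v → CyclicArc D u v

/-- A simple digraph: no loops (`Digraph` already excludes parallel arcs; pairs of opposite arcs
are allowed). -/
def IsSimpleDigraph {V : Type*} (D : Digraph V) : Prop :=
  ∀ v : V, ¬ D.Adj v v

/-- A tournament: no loops, and exactly one arc between any two distinct vertices. -/
def IsTournament {V : Type*} (D : Digraph V) : Prop :=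
  (∀ v : V, ¬ D.Adj v v) ∧ ∀ u v : V, u ≠ v → Xor (D.Adj u v) (D.Adj v u)

/-- The number of totally cyclic orientations of the complete graph on `n` labeled vertices. -/
noncomputable def t (n : ℕ) : ℕ :=
  Set.ncard {D : Digraph (Fin n) | IsOrientation (⊤ : SimpleGraph (Fin n)) D ∧ TotallyCyclic D}

/-- The number of strongly connected fourientations of the complete graph on `n` labeled
vertices. -/
noncomputable def s (n : ℕ) : ℕ :=
  Set.ncard {D : Digraph (Fin n) | IsFourientation (⊤ : SimpleGraph (Fin n)) D ∧ StronglyConnected D}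

/-- The formal power series `∑_{n ≥ 1} a n * x ^ n / n!`. -/
noncomputable def egf (a : ℕ → ℚ) : PowerSeries ℚ :=
  PowerSeries.mk fun n => if n = 0 then 0 else a n / (n.factorial : ℚ)

end Fourientation

/-! Everything follows from evaluating one signed count in two ways. Let b_n be the sum of
(-1)^(number of strong components) over the loopless digraphs on n vertices that are disjoint unions
of strongly connected ones (`signWeight`), with exponential generating function B.

Removing the component of a marked vertex gives n b_n = -∑ C(n,k) k s_k b_(n-k), that is, B' = -S' B
with S the series of the s_n; hence exp(S) B = 1 (`exp_subst_mul_fullEgf_sign`).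

In any loopless digraph, the signs of all sets of source components cancel unless there are no
vertices (`sum_splitWeight_noBack`). Summing over digraphs gives ∑ C(n,k) b_k 2^((n-k)(n-k-1))
2^(k(n-k)) = [n = 0]. Division by 2^C(n,2) turns this into a product of exponential series: the
series of b_k / 2^C(k,2) is inverse to the series T of all tournaments (`fullEgf_sign_div_mul`).

Splitting off the initial strong component of a tournament shows that 1 - ∑ t_n x^n/n! is also
inverse to T. So the two inverses agree, and multiplying the n-th coefficient by 2^C(n,2) gives 1 -
∑ 2^C(n,2) t_n x^n/n! = B = exp(-S). -/

namespace Fourientation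
open Finset Relation Function
open scoped Classical

/-! ### Weighted counts of relations and splitting along a vertex set -/

/-- A rational weight for every relation on every type. -/
abbrev Weight := ∀ V : Type, (V → V → Prop) → ℚ

/-- A weight is isomorphism invariant if relabelling the vertices does not change it. -/
def IsoInvariant (w : Weight) : Prop :=
  ∀ (V W : Type) (e : W ≃ V) (R : V → V → Prop), w W (R on e) = w V R

/-- The total weight of all relations on `n` labeled vertices. -/
noncomputable def count (w : Weight) (n : ℕ) : ℚ :=
  ∑ R : Fin n → Fin n → Prop, w (Fin n) R

lemma sum_eq_count {w : Weight} (hw : IsoInvariant w) {V : Type} [Fintype V] {n : ℕ}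
    [Fintype (V → V → Prop)] (h : Fintype.card V = n) : ∑ R : V → V → Prop, w V R = count w n := by
  let e : Fin n ≃ V := (Fintype.equivFinOfCardEq h).symm
  refine Fintype.sum_equiv
    (e.symm.arrowCongr (e.symm.arrowCongr (Equiv.refl Prop))) _ _ fun R => ?_
  rw [← hw V (Fin n) e R]
  rfl

/-- A relation on `V` amounts to its restrictions to a set and to the complement, together with
the arcs between the two in both directions. -/
noncomputable def splitRel {V : Type} (p : V → Prop) :
    (V → V → Prop) ≃
      (({x // p x} → {x // p x} → Prop) × ({x // ¬ p x} → {x // ¬ p x} → Prop)) ×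
      (({x // p x} → {x // ¬ p x} → Prop) × ({x // ¬ p x} → {x // p x} → Prop)) where
  toFun R := ((R on (↑), R on (↑)), (fun a b => R a b, fun b a => R b a))
  invFun q u v :=
    if hu : p u then
      if hv : p v then q.1.1 ⟨u, hu⟩ ⟨v, hv⟩ else q.2.1 ⟨u, hu⟩ ⟨v, hv⟩
    else
      if hv : p v then q.2.2 ⟨u, hu⟩ ⟨v, hv⟩ else q.1.2 ⟨u, hu⟩ ⟨v, hv⟩
  left_inv R := by
    funext u v
    by_cases hu : p u <;> by_cases hv : p v <;> simp [hu, hv, onFun]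
  right_inv q := by
    obtain ⟨⟨a, b⟩, c, d⟩ := q
    refine Prod.ext (Prod.ext ?_ ?_) (Prod.ext ?_ ?_) <;> funext ⟨u, hu⟩ ⟨v, hv⟩ <;>
      simp [hu, hv, onFun]

/-- A weight for the arcs between two sets of vertices. -/
abbrev CrossWeight := ∀ A B : Type, (A → B → Prop) → (B → A → Prop) → ℚ

/-- The total cross weight between `A` and `B` is `c |A| |B|`. -/
def HasCrossTotal (h : CrossWeight) (c : ℕ → ℕ → ℚ) : Prop :=
  ∀ (A B : Type) [Fintype A] [Fintype B] [Fintype (A → B → Prop)] [Fintype (B → A → Prop)],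
    ∑ X : A → B → Prop, ∑ Y : B → A → Prop, h A B X Y = c (Fintype.card A) (Fintype.card B)

/-- The weight of `R` split along `K`. -/
noncomputable def splitWeight (f g : Weight) (h : CrossWeight) {V : Type} (K : Finset V)
    (R : V → V → Prop) : ℚ :=
  f {x // x ∈ K} (R on (↑)) * g {x // x ∉ K} (R on (↑)) *
    h {x // x ∈ K} {x // x ∉ K} (fun a b => R a b) (fun b a => R b a)

lemma sum_splitWeight {f g : Weight} {h : CrossWeight} {c : ℕ → ℕ → ℚ} (hf : IsoInvariant f)
    (hg : IsoInvariant g) (hh : HasCrossTotal h c) {V : Type} [Fintype V]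
    [Fintype (V → V → Prop)] {n : ℕ} (hn : Fintype.card V = n) (K : Finset V) :
    ∑ R : V → V → Prop, splitWeight f g h K R =
      count f #K * count g (n - #K) * c #K (n - #K) := by
  have hK : Fintype.card {x // x ∈ K} = #K := Fintype.card_coe K
  have hK' : Fintype.card {x // x ∉ K} = n - #K := by
    rw [Fintype.card_subtype_compl, hK, hn]
  have hc := hh {x // x ∈ K} {x // x ∉ K}
  rw [hK, hK'] at hc
  rw [← sum_eq_count hf hK, ← sum_eq_count hg hK', ← hc,
    Fintype.sum_equiv (splitRel (· ∈ K)) (splitWeight f g h K) (fun q => f _ q.1.1 * g _ q.1.2 * h _ _ q.2.1 q.2.2)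
      fun R => rfl]
  simp only [Fintype.sum_prod_type, ← Finset.mul_sum, ← Finset.sum_mul]

/-- The bridge from structure to recursion: an identity for each single `R`, expanding a weight over
vertex sets `K`, becomes a binomial convolution of counts after exchanging the sums and grouping the
`K` by size. -/
lemma sum_sum_splitWeight {f g : Weight} {h : CrossWeight} {c : ℕ → ℕ → ℚ} (hf : IsoInvariant f)
    (hg : IsoInvariant g) (hh : HasCrossTotal h c) (u : ℕ → ℚ) (n : ℕ) :
    ∑ R : Fin n → Fin n → Prop, ∑ K : Finset (Fin n), u #K * splitWeight f g h K R =
      ∑ k ∈ range (n + 1),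
        n.choose k * (u k * (count f k * count g (n - k) * c k (n - k))) := by
  rw [Finset.sum_comm]
  simp_rw [← Finset.mul_sum, sum_splitWeight hf hg hh (Fintype.card_fin n)]
  have := Finset.sum_powerset_apply_card
    (fun k => u k * (count f k * count g (n - k) * c k (n - k))) (x := (univ : Finset (Fin n)))
  simpa using this

/-- The indicator of a proposition. -/
noncomputable def ind (p : Prop) : ℚ := if p then 1 else 0

lemma ind_of_true {p : Prop} (h : p) : ind p = 1 := if_pos h

lemma ind_of_false {p : Prop} (h : ¬ p) : ind p = 0 := if_neg h

lemma ind_mul_ind (p q : Prop) : ind p * ind q = ind (p ∧ q) := by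
  by_cases hp : p <;> by_cases hq : q <;> simp [ind, hp, hq]

lemma sum_ind_eq {α : Type*} [Fintype α] (a : α) : ∑ x, ind (x = a) = 1 := by
  rw [Fintype.sum_eq_single a fun x hx => ind_of_false hx, ind_of_true rfl]

/-- No arcs from the second set to the first. -/
noncomputable def crossNoBack : CrossWeight :=
  fun _ _ _ Y => ind (Y = fun _ _ => False)

/-- All arcs from the first set to the second, and none back. -/
noncomputable def crossForward : CrossWeight :=
  fun _ _ X Y => ind (X = fun _ _ => True) * ind (Y = fun _ _ => False)

/-- No arcs between the two sets. -/
noncomputable def crossNone : CrossWeight :=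
  fun _ _ X Y => ind (X = fun _ _ => False) * ind (Y = fun _ _ => False)

/-- Exactly one arc between any vertex of the first set and any vertex of the second. -/
noncomputable def crossTournament : CrossWeight :=
  fun _ _ X Y => ind (Y = fun b a => ¬ X a b)

/-- Arbitrary arcs between the two sets. -/
def crossAny : CrossWeight := fun _ _ _ _ => 1

lemma card_crossRel (A B : Type) [Fintype A] [Fintype B] [Fintype (A → B → Prop)] :
    (Fintype.card (A → B → Prop) : ℚ) = 2 ^ (Fintype.card A * Fintype.card B) := by
  rw [← Nat.card_eq_fintype_card, Nat.card_fun, Nat.card_fun]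
  simp [← pow_mul, mul_comm]

lemma hasCrossTotal_noBack : HasCrossTotal crossNoBack fun a b => 2 ^ (a * b) := by
  intro A B _ _ _ _
  simp [crossNoBack, sum_ind_eq, card_crossRel]

lemma hasCrossTotal_forward : HasCrossTotal crossForward fun _ _ => 1 := by
  intro A B _ _ _ _
  simp [crossForward, sum_ind_eq, ← Finset.mul_sum]

lemma hasCrossTotal_none : HasCrossTotal crossNone fun _ _ => 1 := by
  intro A B _ _ _ _
  simp [crossNone, sum_ind_eq, ← Finset.mul_sum]

lemma hasCrossTotal_tournament : HasCrossTotal crossTournament fun a b => 2 ^ (a * b) := by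
  intro A B _ _ _ _
  simp [crossTournament, sum_ind_eq, card_crossRel]

lemma hasCrossTotal_any : HasCrossTotal crossAny fun a b => 2 ^ (2 * (a * b)) := by
  intro A B _ _ _ _
  simp only [crossAny, sum_const, card_univ, nsmul_eq_mul, card_crossRel]
  ring

/-! ### Classes of relations, strong components and restriction -/

variable {V W : Type}

/-- No vertex is related to itself. -/
def Loopless (R : V → V → Prop) : Prop := ∀ v, ¬ R v v

/-- A loopless strongly connected relation. -/
def StrongRel (R : V → V → Prop) : Prop := Loopless R ∧ ∀ u v, ReflTransGen R u v

/-- A tournament, as a relation. -/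
def TournamentRel (R : V → V → Prop) : Prop := Loopless R ∧ ∀ u v, u ≠ v → (R v u ↔ ¬ R u v)

/-- A loopless relation that is a disjoint union of strongly connected ones. -/
def BalancedRel (R : V → V → Prop) : Prop := Loopless R ∧ ∀ u v, R u v → ReflTransGen R v u

/-- The strong component of a vertex. -/
def component (R : V → V → Prop) (v : V) : Set V := {u | ReflTransGen R v u ∧ ReflTransGen R u v}

/-- The number of strong components. -/
noncomputable def numComponents (R : V → V → Prop) : ℕ := (Set.range (component R)).ncard

/-- The indicator weight of loopless relations. -/
noncomputable def looplessWeight : Weight := fun _ R => ind (Loopless R)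

/-- The indicator weight of loopless strongly connected relations. -/
noncomputable def strongWeight : Weight := fun _ R => ind (StrongRel R)

/-- The indicator weight of tournaments. -/
noncomputable def tournamentWeight : Weight := fun _ R => ind (TournamentRel R)

/-- The indicator weight of strongly connected tournaments. -/
noncomputable def strongTournamentWeight : Weight := fun _ R => ind (StrongRel R ∧ TournamentRel R)

/-- The weight of a disjoint union of strongly connected relations is the parity of the number
of components. -/
noncomputable def signWeight : Weight := fun _ R => ind (BalancedRel R) * (-1) ^ numComponents R

lemma mem_component_self (R : V → V → Prop) (v : V) : v ∈ component R v := ⟨.refl, .refl⟩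

lemma component_eq_iff {R : V → V → Prop} {u v : V} :
    component R u = component R v ↔ ReflTransGen R u v ∧ ReflTransGen R v u := by
  constructor
  · intro h
    have : v ∈ component R u := h ▸ mem_component_self R v
    exact this
  · rintro ⟨h, h'⟩
    ext w
    exact ⟨fun hw => ⟨h'.trans hw.1, hw.2.trans h⟩, fun hw => ⟨h.trans hw.1, hw.2.trans h'⟩⟩

lemma reflTransGen_of_onFun {R : V → V → Prop} {f : W → V} {a b : W}
    (h : ReflTransGen (R on f) a b) : ReflTransGen R (f a) (f b) :=
  h.lift f fun _ _ h => h

/-- The range of `f` is closed under predecessors, so a path ending in it lies in it entirely and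
can be lifted backwards from its end. -/
lemma exists_of_reflTransGen {R : V → V → Prop} {f : W → V}
    (hR : ∀ u b, R u (f b) → ∃ a, f a = u) {u : V} {b : W} (h : ReflTransGen R u (f b)) :
    ∃ a, f a = u ∧ ReflTransGen (R on f) a b := by
  induction h using ReflTransGen.head_induction_on with
  | refl => exact ⟨b, rfl, .refl⟩
  | head huv _ ih =>
    obtain ⟨a, rfl, ha⟩ := ih
    obtain ⟨c, rfl⟩ := hR _ _ huv
    exact ⟨c, rfl, .head huv ha⟩

lemma reflTransGen_onFun_iff {R : V → V → Prop} {f : W → V} (hf : Injective f)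
    (hR : ∀ u b, R u (f b) → ∃ a, f a = u) {a b : W} :
    ReflTransGen (R on f) a b ↔ ReflTransGen R (f a) (f b) := by
  refine ⟨reflTransGen_of_onFun, fun h => ?_⟩
  obtain ⟨c, hc, h⟩ := exists_of_reflTransGen hR h
  exact hf hc ▸ h

/-- Both ranges are the quotient of `α` by the same kernel. -/
lemma ncard_range_eq {α β γ : Type*} {g : α → β} {h : α → γ} (H : ∀ a b, g a = g b ↔ h a = h b) :
    (Set.range g).ncard = (Set.range h).ncard := by
  have hk : Setoid.ker g = Setoid.ker h := Setoid.ext fun a b => H a b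
  have hg := Nat.card_congr (Setoid.quotientKerEquivRange g)
  have hh := Nat.card_congr (Setoid.quotientKerEquivRange h)
  rw [hk] at hg
  exact hg.symm.trans hh

lemma numComponents_onFun {R : V → V → Prop} {f : W → V} (hf : Injective f)
    (hR : ∀ u b, R u (f b) → ∃ a, f a = u) :
    numComponents (R on f) = (Set.range (component R ∘ f)).ncard :=
  ncard_range_eq fun a b => by
    simp only [comp_apply, component_eq_iff, reflTransGen_onFun_iff hf hR]

section Invariance

variable (e : W ≃ V) (R : V → V → Prop)

lemma reflTransGen_onEquiv {a b : W} :
    ReflTransGen (R on e) a b ↔ ReflTransGen R (e a) (e b) :=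
  reflTransGen_onFun_iff e.injective fun u _ _ => e.surjective u

lemma loopless_onEquiv : Loopless (R on e) ↔ Loopless R :=
  e.forall_congr fun _ => Iff.rfl

lemma strongRel_onEquiv : StrongRel (R on e) ↔ StrongRel R :=
  and_congr (loopless_onEquiv e R) (Equiv.forall₂_congr e e (reflTransGen_onEquiv e R))

lemma tournamentRel_onEquiv : TournamentRel (R on e) ↔ TournamentRel R :=
  and_congr (loopless_onEquiv e R) (Equiv.forall₂_congr e e (by simp [onFun]))

lemma balancedRel_onEquiv : BalancedRel (R on e) ↔ BalancedRel R :=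
  and_congr (loopless_onEquiv e R)
    (Equiv.forall₂_congr e e (imp_congr Iff.rfl (reflTransGen_onEquiv e R)))

lemma numComponents_onEquiv : numComponents (R on e) = numComponents R := by
  rw [numComponents_onFun e.injective fun u _ _ => e.surjective u, e.surjective.range_comp]
  rfl

end Invariance

lemma isoInvariant_loopless : IsoInvariant looplessWeight := fun _ _ e R => by
  simp only [looplessWeight, loopless_onEquiv]

lemma isoInvariant_strong : IsoInvariant strongWeight := fun _ _ e R => by
  simp only [strongWeight, strongRel_onEquiv]

lemma isoInvariant_tournament : IsoInvariant tournamentWeight := fun _ _ e R => by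
  simp only [tournamentWeight, tournamentRel_onEquiv]

lemma isoInvariant_strongTournament : IsoInvariant strongTournamentWeight := fun _ _ e R => by
  simp only [strongTournamentWeight, strongRel_onEquiv, tournamentRel_onEquiv]

lemma isoInvariant_sign : IsoInvariant signWeight := fun _ _ e R => by
  simp only [signWeight, balancedRel_onEquiv, numComponents_onEquiv]

/-- A vertex with the fewest ancestors lies in a source component: an ancestor `u` of it has no more
ancestors than it, hence exactly the same ones, among them `v`. -/
lemma exists_source [Finite V] [Nonempty V] (R : V → V → Prop) :
    ∃ v, ∀ u, ReflTransGen R u v → ReflTransGen R v u := by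
  obtain ⟨v, hv⟩ := Finite.exists_min fun v : V => {u | ReflTransGen R u v}.ncard
  refine ⟨v, fun u huv => ?_⟩
  have hsub : {w | ReflTransGen R w u} ⊆ {w | ReflTransGen R w v} := fun w hw => hw.trans huv
  have heq := Set.eq_of_subset_of_ncard_le hsub (hv u)
  have : v ∈ {w | ReflTransGen R w v} := ReflTransGen.refl
  rwa [← heq] at this

section Subsets

variable {R : V → V → Prop} {K : Finset V}

lemma reflTransGen_coe_iff (hK : ∀ u v, R u v → v ∈ K → u ∈ K) {a b : {x // x ∈ K}} :
    ReflTransGen (R on ((↑) : {x // x ∈ K} → V)) a b ↔ ReflTransGen R a b :=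
  reflTransGen_onFun_iff Subtype.val_injective fun u b h => ⟨⟨u, hK u b h b.2⟩, rfl⟩

lemma reflTransGen_coe_compl_iff (hK : ∀ u v, R u v → u ∈ K → v ∈ K) {a b : {x // x ∉ K}} :
    ReflTransGen (R on ((↑) : {x // x ∉ K} → V)) a b ↔ ReflTransGen R a b :=
  reflTransGen_onFun_iff Subtype.val_injective fun u b h =>
    ⟨⟨u, fun hu => absurd (hK u b h hu) b.2⟩, rfl⟩

lemma mem_of_reflTransGen (hK : ∀ u v, R u v → v ∈ K → u ∈ K) {u v : V}
    (h : ReflTransGen R u v) (hv : v ∈ K) : u ∈ K := by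
  induction h using ReflTransGen.head_induction_on with
  | refl => exact hv
  | head huv _ ih => exact hK _ _ huv ih

lemma mem_of_reflTransGen' (hK : ∀ u v, R u v → u ∈ K → v ∈ K) {u v : V}
    (h : ReflTransGen R u v) (hu : u ∈ K) : v ∈ K := by
  induction h with
  | refl => exact hu
  | tail _ huv ih => exact hK _ _ huv ih

lemma loopless_of_split (h : Loopless (R on ((↑) : {x // x ∈ K} → V)))
    (h' : Loopless (R on ((↑) : {x // x ∉ K} → V))) : Loopless R := fun v => by
  by_cases hv : v ∈ K
  · exact h ⟨v, hv⟩
  · exact h' ⟨v, hv⟩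

lemma Loopless.onFun (h : Loopless R) (f : W → V) : Loopless (R on f) := fun v => h (f v)

lemma TournamentRel.onFun (h : TournamentRel R) {f : W → V} (hf : Injective f) :
    TournamentRel (R on f) :=
  ⟨h.1.onFun f, fun u v huv => h.2 (f u) (f v) (hf.ne huv)⟩

lemma tournamentRel_of_split (h : TournamentRel (R on ((↑) : {x // x ∈ K} → V)))
    (h' : TournamentRel (R on ((↑) : {x // x ∉ K} → V)))
    (hc : ∀ u ∈ K, ∀ v ∉ K, (R v u ↔ ¬ R u v)) : TournamentRel R := by
  refine ⟨loopless_of_split h.1 h'.1, fun u v huv => ?_⟩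
  by_cases hu : u ∈ K <;> by_cases hv : v ∈ K
  · exact h.2 ⟨u, hu⟩ ⟨v, hv⟩ (by simpa using huv)
  · exact hc u hu v hv
  · have := hc v hv u hu
    tauto
  · exact h'.2 ⟨u, hu⟩ ⟨v, hv⟩ (by simpa using huv)

end Subsets

/-! ### Splitting off one strong component -/

section InitialComponent

variable (R : V → V → Prop)

lemma splitWeight_forward (K : Finset V) :
    splitWeight strongTournamentWeight tournamentWeight crossForward K R =
      ind ((StrongRel (R on ((↑) : {x // x ∈ K} → V)) ∧
        TournamentRel (R on ((↑) : {x // x ∈ K} → V))) ∧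
        TournamentRel (R on ((↑) : {x // x ∉ K} → V)) ∧ ∀ u ∈ K, ∀ v ∉ K, R u v ∧ ¬ R v u) := by
  simp only [splitWeight, strongTournamentWeight, tournamentWeight, crossForward, ind_mul_ind]
  congr 1
  simp only [funext_iff, eq_iff_iff, iff_true, iff_false, Subtype.forall, and_assoc]
  refine and_congr_right fun _ => and_congr_right fun _ => and_congr_right fun _ => ?_
  exact ⟨fun h u hu v hv => ⟨h.1 u hu v hv, h.2 v hv u hu⟩,
    fun h => ⟨fun u hu v hv => (h u hu v hv).1, fun v hv u hu => (h u hu v hv).2⟩⟩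

/-- A nonempty tournament splits uniquely into its initial strong component and the rest. -/
lemma tournamentWeight_eq_sum [Fintype V] [Nonempty V] :
    tournamentWeight V R = ∑ K : Finset V, (if #K = 0 then 0 else 1) *
      splitWeight strongTournamentWeight tournamentWeight crossForward K R := by
  simp only [splitWeight_forward, tournamentWeight]
  by_cases hR : TournamentRel R
  · rw [ind_of_true hR]
    set I : Finset V := univ.filter fun v => ∀ u, ReflTransGen R v u with hI
    have memI : ∀ v, v ∈ I ↔ ∀ u, ReflTransGen R v u := by simp [hI]
    have hback : ∀ u v, R u v → v ∈ I → u ∈ I := fun u v huv hv =>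
      (memI u).2 fun w => .head huv ((memI v).1 hv w)
    rw [Fintype.sum_eq_single I, ind_of_true, if_neg, mul_one]
    · obtain ⟨v, hv⟩ := exists_source R
      -- In a tournament a source vertex reaches everything: otherwise `u` has an arc to `v`, and
      -- the source property provides the way back.
      have : v ∈ I := (memI v).2 fun u => by
        by_cases huv : v = u
        · exact huv ▸ .refl
        · by_cases h : R v u
          · exact .single h
          · exact hv u (.single ((hR.2 v u huv).2 h))
      exact card_ne_zero_of_mem this
    · refine ⟨⟨⟨hR.1.onFun _, fun u v => ?_⟩, hR.onFun Subtype.val_injective⟩,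
        hR.onFun Subtype.val_injective, fun u hu v hv => ?_⟩
      · exact (reflTransGen_coe_iff hback).2 ((memI u).1 u.2 v)
      · have h : ¬ R v u := fun h => hv (hback v u h hu)
        exact ⟨(hR.2 v u fun h => hv (h ▸ hu)).2 h, h⟩
    · intro K hK
      -- The empty relation is vacuously strong, so the empty set has to be excluded by the
      -- coefficient.
      by_cases h0 : #K = 0
      · simp [h0]
      rw [if_neg h0, one_mul]
      refine ind_of_false fun ⟨⟨hs, _⟩, _, hc⟩ => hK ?_
      obtain ⟨k, hk⟩ := card_ne_zero.1 h0
      have hfwd : ∀ u v, R u v → v ∈ K → u ∈ K := fun u v huv hv => by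
        by_contra hu
        exact (hc v hv u hu).2 huv
      ext v
      rw [memI]
      constructor
      · intro hv u
        by_cases hu : u ∈ K
        · exact reflTransGen_of_onFun (hs.2 ⟨v, hv⟩ ⟨u, hu⟩)
        · exact .single (hc v hv u hu).1
      · intro hv
        exact mem_of_reflTransGen hfwd (hv k) hk
  · rw [ind_of_false hR, Finset.sum_eq_zero]
    intro K _
    rw [ind_of_false, mul_zero]
    rintro ⟨⟨_, h⟩, h', hc⟩
    refine hR (tournamentRel_of_split h h' fun u hu v hv => ?_)
    have := hc u hu v hv
    tauto

/-- With no arcs to the outside, the strong set `K` is exactly the component of `v`, and the other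
components are unaffected by its removal. This is the source of the minus sign in the recursion for
`signWeight`. -/
lemma numComponents_splitNone {K : Finset V} [Finite V] {v : V} (hv : v ∈ K)
    (hs : StrongRel (R on ((↑) : {x // x ∈ K} → V))) (hc : ∀ u ∈ K, ∀ v ∉ K, ¬ R u v ∧ ¬ R v u) :
    numComponents R = numComponents (R on ((↑) : {x // x ∉ K} → V)) + 1 := by
  have hback : ∀ u v, R u v → v ∈ K → u ∈ K := fun u v huv hv => by
    by_contra hu
    exact (hc v hv u hu).2 huv
  have hfwd : ∀ u v, R u v → u ∈ K → v ∈ K := fun u v huv hu => by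
    by_contra hv
    exact (hc u hu v hv).1 huv
  rw [numComponents_onFun Subtype.val_injective fun u b h =>
    ⟨⟨u, fun hu => absurd (hfwd u b h hu) b.2⟩, rfl⟩, numComponents,
    ← Set.ncard_insert_of_notMem (a := component R v) ?_ (Set.toFinite _)]
  · congr 1
    ext C
    constructor
    · rintro ⟨u, rfl⟩
      by_cases hu : u ∈ K
      · left
        exact component_eq_iff.2 ⟨reflTransGen_of_onFun (hs.2 ⟨u, hu⟩ ⟨v, hv⟩),
          reflTransGen_of_onFun (hs.2 ⟨v, hv⟩ ⟨u, hu⟩)⟩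
      · exact Or.inr ⟨⟨u, hu⟩, rfl⟩
    · rintro (rfl | ⟨u, rfl⟩)
      · exact ⟨v, rfl⟩
      · exact ⟨u, rfl⟩
  · rintro ⟨u, hu⟩
    exact u.2 (mem_of_reflTransGen hback (component_eq_iff.1 hu).1 hv)

lemma splitWeight_none (K : Finset V) :
    splitWeight strongWeight signWeight crossNone K R =
      ind (StrongRel (R on ((↑) : {x // x ∈ K} → V)) ∧
        BalancedRel (R on ((↑) : {x // x ∉ K} → V)) ∧ ∀ u ∈ K, ∀ v ∉ K, ¬ R u v ∧ ¬ R v u) *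
      (-1) ^ numComponents (R on ((↑) : {x // x ∉ K} → V)) := by
  have : ∀ a b c d e : ℚ, a * (b * c) * (d * e) = (a * (b * (d * e))) * c := by intros; ring
  simp only [splitWeight, strongWeight, signWeight, crossNone]
  rw [this, ind_mul_ind, ind_mul_ind, ind_mul_ind]
  congr 2
  simp only [funext_iff, eq_iff_iff, iff_false, Subtype.forall]
  refine and_congr_right fun _ => and_congr_right fun _ => ?_
  exact ⟨fun h u hu v hv => ⟨h.1 u hu v hv, h.2 v hv u hu⟩,
    fun h => ⟨fun u hu v hv => (h u hu v hv).1, fun v hv u hu => (h u hu v hv).2⟩⟩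

lemma BalancedRel.symm {R : V → V → Prop} (hR : BalancedRel R) {u v : V}
    (h : ReflTransGen R u v) : ReflTransGen R v u := by
  induction h with
  | refl => exact .refl
  | tail _ h ih => exact (hR.2 _ _ h).trans ih

/-- A balanced relation splits into the component of a vertex and the rest. -/
lemma signWeight_eq_sum_of_vertex [Fintype V] (v : V) :
    signWeight V R = ∑ K : Finset V, (if v ∈ K then 1 else 0) *
      -splitWeight strongWeight signWeight crossNone K R := by
  simp only [splitWeight_none, signWeight]
  by_cases hR : BalancedRel R
  · set I : Finset V := univ.filter fun u => ReflTransGen R v u with hI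
    have memI : ∀ u, u ∈ I ↔ ReflTransGen R v u := by simp [hI]
    have hfwd : ∀ u w, R u w → u ∈ I → w ∈ I := fun u w huw hu =>
      (memI w).2 (((memI u).1 hu).tail huw)
    have hback : ∀ u w, R u w → w ∈ I → u ∈ I := fun u w huw hw =>
      (memI u).2 (((memI w).1 hw).trans (hR.2 u w huw))
    have hv : v ∈ I := (memI v).2 .refl
    have hs : StrongRel (R on ((↑) : {x // x ∈ I} → V)) :=
      ⟨hR.1.onFun _, fun a b => (reflTransGen_coe_iff hback).2
        ((hR.symm ((memI a).1 a.2)).trans ((memI b).1 b.2))⟩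
    have hc : ∀ u ∈ I, ∀ w ∉ I, ¬ R u w ∧ ¬ R w u := fun u hu w hw =>
      ⟨fun h => hw (hfwd u w h hu), fun h => hw (hback w u h hu)⟩
    rw [ind_of_true hR, Fintype.sum_eq_single I, ind_of_true, if_pos hv,
      numComponents_splitNone R hv hs hc]
    · ring
    · exact ⟨hs, ⟨hR.1.onFun _, fun a b h => (reflTransGen_coe_compl_iff hfwd).2 (hR.2 _ _ h)⟩, hc⟩
    · intro K hK
      by_cases h0 : v ∈ K
      · rw [ind_of_false, zero_mul, neg_zero, mul_zero]
        rintro ⟨hs, _, hc⟩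
        refine hK ?_
        have hfwd : ∀ u w, R u w → u ∈ K → w ∈ K := fun u w huw hu => by
          by_contra hw
          exact (hc u hu w hw).1 huw
        ext u
        rw [memI]
        exact ⟨fun hu => reflTransGen_of_onFun (hs.2 ⟨v, h0⟩ ⟨u, hu⟩),
          fun h => mem_of_reflTransGen' hfwd h h0⟩
      · rw [if_neg h0, zero_mul]
  · rw [ind_of_false hR, zero_mul, Finset.sum_eq_zero]
    intro K _
    rw [ind_of_false, zero_mul, neg_zero, mul_zero]
    rintro ⟨hs, hb, hc⟩
    refine hR ⟨loopless_of_split hs.1 hb.1, fun u w huw => ?_⟩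
    by_cases hu : u ∈ K <;> by_cases hw : w ∈ K
    · exact reflTransGen_of_onFun (hs.2 ⟨w, hw⟩ ⟨u, hu⟩)
    · exact absurd huw (hc u hu w hw).1
    · exact absurd huw (hc w hw u hu).2
    · exact reflTransGen_of_onFun (hb.2 ⟨u, hu⟩ ⟨w, hw⟩ huw)

/-- Sum the vertex decomposition over all `v`: each `K` is then counted once for each of its
elements. -/
lemma card_mul_signWeight [Fintype V] :
    Fintype.card V * signWeight V R = ∑ K : Finset V, -(#K : ℚ) *
      splitWeight strongWeight signWeight crossNone K R := by
  have h : ∑ v : V, signWeight V R = Fintype.card V * signWeight V R := by simp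
  rw [← h, Finset.sum_congr rfl fun v _ => signWeight_eq_sum_of_vertex R v, Finset.sum_comm]
  refine Finset.sum_congr rfl fun K _ => ?_
  rw [← Finset.sum_mul]
  simp

end InitialComponent

/-! ### Cancellation over sets of source components -/

section SourceComponents

variable (R : V → V → Prop)

lemma splitWeight_noBack (K : Finset V) :
    splitWeight signWeight looplessWeight crossNoBack K R =
      ind (BalancedRel (R on ((↑) : {x // x ∈ K} → V)) ∧
        Loopless (R on ((↑) : {x // x ∉ K} → V)) ∧ ∀ u v, R u v → v ∈ K → u ∈ K) *
      (-1) ^ numComponents (R on ((↑) : {x // x ∈ K} → V)) := by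
  have : ∀ a b c d : ℚ, a * b * c * d = (a * (c * d)) * b := by intros; ring
  simp only [splitWeight, looplessWeight, signWeight, crossNoBack]
  rw [this, ind_mul_ind, ind_mul_ind]
  congr 2
  simp only [funext_iff, eq_iff_iff, iff_false, Subtype.forall]
  refine and_congr_right fun _ => and_congr_right fun _ => ?_
  exact ⟨fun h u v huv hv => by_contra fun hu => h u hu v hv huv,
    fun h u hu v hv huv => hu (h u v huv hv)⟩

/-- The signs of the unions of source components cancel. -/
lemma sum_splitWeight_noBack [Fintype V] :
    ∑ K : Finset V, splitWeight signWeight looplessWeight crossNoBack K R = ind (IsEmpty V) := by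
  simp only [splitWeight_noBack]
  by_cases hR : Loopless R
  · set P : Finset V → Prop := fun K => BalancedRel (R on ((↑) : {x // x ∈ K} → V)) ∧
      Loopless (R on ((↑) : {x // x ∉ K} → V)) ∧ ∀ u v, R u v → v ∈ K → u ∈ K with hP
    -- `C` is the set of source components. The admissible `K` are exactly the unions of subsets of
    -- `C`, and the sign of `K` is the parity of that subset.
    set C : Finset (Set V) :=
      (univ.filter fun v => ∀ u, ReflTransGen R u v → ReflTransGen R v u).image (component R) with hC
    have memC : ∀ v, component R v ∈ C ↔ ∀ u, ReflTransGen R u v → ReflTransGen R v u := by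
      intro v
      simp only [hC, mem_image, mem_filter, mem_univ, true_and]
      refine ⟨?_, fun h => ⟨v, h, rfl⟩⟩
      rintro ⟨w, hw, hwv⟩ u huv
      obtain ⟨h1, h2⟩ := component_eq_iff.1 hwv
      exact h2.trans (hw u (huv.trans h2))
    have key : ∑ K : Finset V with P K, (-1 : ℚ) ^ #(K.image (component R)) =
        ∑ S ∈ C.powerset, (-1 : ℚ) ^ #S := by
      refine Finset.sum_bij' (fun K _ => K.image (component R))
        (fun S _ => univ.filter fun v => component R v ∈ S) ?_ ?_ ?_ ?_ ?_
      · intro K hK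
        obtain ⟨hb, _, hc⟩ := (mem_filter.1 hK).2
        rw [mem_powerset]
        intro c hcK
        obtain ⟨v, hv, rfl⟩ := mem_image.1 hcK
        refine (memC v).2 fun u huv => ?_
        have hu := mem_of_reflTransGen hc huv hv
        exact reflTransGen_of_onFun (f := ((↑) : {x // x ∈ K} → V)) (a := ⟨v, hv⟩) (b := ⟨u, hu⟩)
          (hb.symm ((reflTransGen_coe_iff hc).2 huv))
      · intro S hS
        rw [mem_powerset] at hS
        have hc : ∀ u v, R u v → v ∈ univ.filter (fun v => component R v ∈ S) →
            u ∈ univ.filter fun v => component R v ∈ S := by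
          intro u v huv hv
          simp only [mem_filter, mem_univ, true_and] at hv ⊢
          rwa [component_eq_iff.2 ⟨.single huv, (memC v).1 (hS hv) u (.single huv)⟩]
        refine mem_filter.2 ⟨mem_univ _, ⟨hR.onFun _, fun u v huv => ?_⟩, hR.onFun _, hc⟩
        rw [reflTransGen_coe_iff hc]
        exact (memC v).1 (hS (mem_filter.1 v.2).2) u (.single huv)
      · intro K hK
        obtain ⟨_, _, hc⟩ := (mem_filter.1 hK).2
        ext v
        simp only [mem_filter, mem_univ, true_and, mem_image]
        refine ⟨?_, fun h => ⟨v, h, rfl⟩⟩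
        rintro ⟨w, hw, h⟩
        exact mem_of_reflTransGen hc (component_eq_iff.1 h).2 hw
      · intro S hS
        rw [mem_powerset] at hS
        ext c
        simp only [mem_filter, mem_univ, true_and, mem_image]
        constructor
        · rintro ⟨v, hv, rfl⟩
          exact hv
        · intro hc
          obtain ⟨v, _, rfl⟩ := mem_image.1 (hS hc)
          exact ⟨v, hc, rfl⟩
      · intro K _
        rfl
    have hsum : ∑ K : Finset V, ind (P K) *
        (-1) ^ numComponents (R on ((↑) : {x // x ∈ K} → V)) =
        ∑ K : Finset V with P K, (-1 : ℚ) ^ #(K.image (component R)) := by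
      rw [Finset.sum_filter]
      refine Finset.sum_congr rfl fun K _ => ?_
      by_cases hK : P K
      · rw [ind_of_true hK, if_pos hK, one_mul, numComponents_onFun Subtype.val_injective
          fun u b h => ⟨⟨u, hK.2.2 u b h b.2⟩, rfl⟩, ← Set.ncard_coe_finset]
        congr 2
        ext c
        simp
      · rw [ind_of_false hK, if_neg hK, zero_mul]
    rw [hsum, key]
    -- The alternating sum over subsets of `C` vanishes unless `C` is empty, and by `exists_source`
    -- this happens only without vertices.
    have hpow := Finset.sum_powerset_neg_one_pow_card (x := C)
    have hpow' : ∑ S ∈ C.powerset, (-1 : ℚ) ^ #S = if C = ∅ then 1 else 0 := by exact_mod_cast hpow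
    rw [hpow']
    rcases isEmpty_or_nonempty V with hV | hV
    · rw [ind_of_true hV, if_pos]
      simp [hC]
    · obtain ⟨v, hv⟩ := exists_source R
      rw [ind_of_false (not_isEmpty_iff.2 hV), if_neg]
      exact ne_empty_of_mem ((memC v).2 hv)
  · rw [ind_of_false fun hV : IsEmpty V => hR fun v => hV.elim v, Finset.sum_eq_zero]
    intro K _
    rw [ind_of_false, zero_mul]
    rintro ⟨hb, hl, _⟩
    exact hR (loopless_of_split hb.1 hl)

end SourceComponents

/-! ### Counts and their recursions -/

section Count

lemma splitWeight_any (K : Finset V) (R : V → V → Prop) :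
    splitWeight looplessWeight looplessWeight crossAny K R = looplessWeight V R := by
  simp only [splitWeight, looplessWeight, crossAny, mul_one, ind_mul_ind]
  exact congrArg ind (propext ⟨fun h => loopless_of_split h.1 h.2, fun h => ⟨h.onFun _, h.onFun _⟩⟩)

lemma splitWeight_tournament (K : Finset V) (R : V → V → Prop) :
    splitWeight tournamentWeight tournamentWeight crossTournament K R = tournamentWeight V R := by
  simp only [splitWeight, tournamentWeight, crossTournament, ind_mul_ind]
  refine congrArg ind (propext ⟨fun h => ?_, fun h => ⟨⟨h.onFun Subtype.val_injective,
    h.onFun Subtype.val_injective⟩, ?_⟩⟩)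
  · refine tournamentRel_of_split h.1.1 h.1.2 fun u hu v hv => ?_
    exact iff_of_eq (congrFun (congrFun h.2 ⟨v, hv⟩) ⟨u, hu⟩)
  · funext v u
    exact propext (h.2 u v fun huv => v.2 (huv ▸ u.2))

lemma count_of_subsingleton {w : Weight} {n : ℕ} (hn : n ≤ 1)
    (hw : ∀ R : Fin n → Fin n → Prop, w (Fin n) R = ind (Loopless R)) : count w n = 1 := by
  have : Subsingleton (Fin n) := Fin.subsingleton_iff_le_one.2 hn
  rw [count, ← sum_ind_eq fun _ _ : Fin n => False]
  refine Finset.sum_congr rfl fun R _ => ?_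
  rw [hw]
  simp only [Loopless, funext_iff, eq_iff_iff, iff_false]
  exact congrArg ind (propext ⟨fun h u v => Subsingleton.elim u v ▸ h u, fun h v => h v v⟩)

lemma tournamentRel_of_subsingleton [Subsingleton V] (R : V → V → Prop) :
    TournamentRel R ↔ Loopless R :=
  ⟨fun h => h.1, fun h => ⟨h, fun u v huv => absurd (Subsingleton.elim u v) huv⟩⟩

lemma count_loopless (n : ℕ) : count looplessWeight n = 2 ^ (n * (n - 1)) := by
  induction n with
  | zero => exact count_of_subsingleton zero_le_one fun _ => rfl
  | succ n ih =>
    -- Splitting along the single vertex 0 of `Fin (n + 1)` gives the induction step.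
    have h := sum_splitWeight isoInvariant_loopless isoInvariant_loopless hasCrossTotal_any
      (Fintype.card_fin (n + 1)) {0}
    simp only [splitWeight_any, card_singleton, add_tsub_cancel_right] at h
    rw [count, h, ih, count_of_subsingleton le_rfl fun _ => rfl, one_mul, ← pow_add]
    congr 1
    cases n with
    | zero => rfl
    | succ n =>
      simp only [add_tsub_cancel_right]
      ring

lemma count_tournament (n : ℕ) : count tournamentWeight n = 2 ^ n.choose 2 := by
  have base : ∀ n ≤ 1, count tournamentWeight n = 1 := fun n hn =>
    count_of_subsingleton hn fun R => by
      have : Subsingleton (Fin n) := Fin.subsingleton_iff_le_one.2 hn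
      rw [tournamentWeight, tournamentRel_of_subsingleton]
  induction n with
  | zero => exact base 0 zero_le_one
  | succ n ih =>
    have h := sum_splitWeight isoInvariant_tournament isoInvariant_tournament
      hasCrossTotal_tournament (Fintype.card_fin (n + 1)) {0}
    simp only [splitWeight_tournament, card_singleton, add_tsub_cancel_right] at h
    rw [count, h, ih, base 1 le_rfl, one_mul, ← pow_add]
    congr 1
    rw [Nat.choose_succ_succ' n 1]
    simp [add_comm]

lemma count_tournament_eq_sum {n : ℕ} (hn : n ≠ 0) :
    count tournamentWeight n = ∑ k ∈ range (n + 1), n.choose k *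
      ((if k = 0 then 0 else count strongTournamentWeight k) * count tournamentWeight (n - k)) := by
  have : Nonempty (Fin n) := Fin.pos_iff_nonempty.1 (Nat.pos_of_ne_zero hn)
  have h := sum_sum_splitWeight isoInvariant_strongTournament isoInvariant_tournament
    hasCrossTotal_forward (fun k => if k = 0 then 0 else 1) n
  simp only [← tournamentWeight_eq_sum] at h
  rw [count, h]
  refine Finset.sum_congr rfl fun k _ => ?_
  split_ifs <;> ring

lemma mul_count_sign (n : ℕ) :
    n * count signWeight n = -∑ k ∈ range (n + 1), n.choose k *
      (k * count strongWeight k * count signWeight (n - k)) := by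
  have h := sum_sum_splitWeight isoInvariant_strong isoInvariant_sign
    hasCrossTotal_none (fun k => -(k : ℚ)) n
  simp only [← card_mul_signWeight, Fintype.card_fin, ← Finset.mul_sum] at h
  rw [count, h, ← Finset.sum_neg_distrib]
  refine Finset.sum_congr rfl fun k _ => ?_
  ring

lemma sum_count_sign (n : ℕ) :
    ∑ k ∈ range (n + 1), n.choose k * (count signWeight k * 2 ^ ((n - k) * (n - k - 1)) *
      2 ^ (k * (n - k))) = if n = 0 then 1 else 0 := by
  have h := sum_sum_splitWeight isoInvariant_sign isoInvariant_loopless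
    hasCrossTotal_noBack (fun _ => 1) n
  simp only [one_mul, sum_splitWeight_noBack, count_loopless] at h
  rw [← h]
  rcases n with _ | n
  · simp [ind, Fin.isEmpty']
  · simp [ind]

end Count

/-! ### From digraphs to weighted counts of relations -/

section Digraphs

variable {V : Type} {D : Digraph V}

lemma isFourientation_top_iff :
    IsFourientation (⊤ : SimpleGraph V) D ↔ IsSimpleDigraph D := by
  simp only [IsFourientation, IsSimpleDigraph, SimpleGraph.top_adj]
  exact ⟨fun h v hv => h v v hv rfl, fun h u v huv e => h u (by rwa [← e] at huv)⟩

lemma isOrientation_top_iff : IsOrientation (⊤ : SimpleGraph V) D ↔ IsTournament D := by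
  rw [IsOrientation, isFourientation_top_iff]
  rfl

lemma isTournament_iff : IsTournament D ↔ TournamentRel D.Adj := by
  refine and_congr Iff.rfl (forall₃_congr fun u v _ => ?_)
  rw [xor_iff_iff_not]
  tauto

/-- Any two distinct vertices are joined by an arc; if that arc has the wrong direction, its being
cyclic supplies the return path. -/
lemma totallyCyclic_iff_of_isTournament (hD : IsTournament D) :
    TotallyCyclic D ↔ StronglyConnected D := by
  constructor
  · intro h u v
    by_cases huv : u = v
    · exact huv ▸ .refl
    · rcases hD.2 u v huv with h1 | h1
      · exact .single h1.1
      · exact (h v u h1).2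
  · exact fun h u v huv => ⟨huv.1, h v u⟩

lemma ncard_digraph_eq_sum [Fintype (V → V → Prop)] (P : (V → V → Prop) → Prop) :
    (Set.ncard {D : Digraph V | P D.Adj} : ℚ) = ∑ R : V → V → Prop, ind (P R) := by
  let e : Digraph V ≃ (V → V → Prop) := ⟨Digraph.Adj, Digraph.mk, fun _ => rfl, fun _ => rfl⟩
  have h : {D : Digraph V | P D.Adj} = e ⁻¹' ↑(univ.filter P) := by
    ext D
    simp [e]
  rw [h, Set.ncard_preimage_of_injective_subset_range e.injective fun R _ => e.surjective R,
    Set.ncard_coe_finset, Finset.card_filter]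
  push_cast
  rfl

end Digraphs

lemma t_eq_ncard (n : ℕ) :
    t n = Set.ncard {D : Digraph (Fin n) | IsTournament D ∧ StronglyConnected D} := by
  rw [t]
  congr 1
  ext D
  rw [Set.mem_ofPred_eq, isOrientation_top_iff]
  exact and_congr_right totallyCyclic_iff_of_isTournament

lemma s_eq_ncard (n : ℕ) :
    s n = Set.ncard {D : Digraph (Fin n) | IsSimpleDigraph D ∧ StronglyConnected D} := by
  simp only [s, isFourientation_top_iff]

lemma t_eq_count (n : ℕ) : (t n : ℚ) = count strongTournamentWeight n := by
  rw [t_eq_ncard]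
  refine Eq.trans ?_ (ncard_digraph_eq_sum fun R => StrongRel R ∧ TournamentRel R)
  congr 2
  ext D
  rw [Set.mem_ofPred_eq, isTournament_iff]
  exact ⟨fun h => ⟨⟨h.1.1, h.2⟩, h.1⟩, fun h => ⟨h.2, h.1.2⟩⟩

lemma s_eq_count (n : ℕ) : (s n : ℚ) = count strongWeight n := by
  rw [s_eq_ncard]
  exact ncard_digraph_eq_sum StrongRel

/-! ### Exponential generating functions -/

open PowerSeries

/-- The exponential generating function of a sequence, with its constant term. -/
noncomputable def fullEgf (a : ℕ → ℚ) : PowerSeries ℚ :=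
  PowerSeries.mk fun n => a n / (n.factorial : ℚ)

lemma egf_eq_fullEgf (a : ℕ → ℚ) : egf a = fullEgf fun n => if n = 0 then 0 else a n := by
  ext n
  by_cases hn : n = 0 <;> simp [egf, fullEgf, hn]

lemma one_eq_fullEgf : (1 : PowerSeries ℚ) = fullEgf fun n => if n = 0 then 1 else 0 := by
  ext n
  by_cases hn : n = 0 <;> simp [fullEgf, coeff_one, hn]

lemma fullEgf_mul (a b : ℕ → ℚ) : fullEgf a * fullEgf b =
    fullEgf fun n => ∑ k ∈ range (n + 1), n.choose k * (a k * b (n - k)) := by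
  ext n
  rw [coeff_mul, Finset.Nat.sum_antidiagonal_eq_sum_range_succ_mk]
  simp only [fullEgf, coeff_mk, Finset.sum_div]
  refine Finset.sum_congr rfl fun k hk => ?_
  rw [Nat.cast_choose ℚ (Nat.lt_succ_iff.1 (mem_range.1 hk))]
  have := Nat.factorial_ne_zero n
  field_simp

lemma X_mul_derivative_fullEgf (a : ℕ → ℚ) :
    X * d⁄dX ℚ (fullEgf a) = fullEgf fun n => n * a n := by
  ext n
  cases n with
  | zero => simp [fullEgf]
  | succ n =>
    rw [coeff_succ_X_mul, coeff_derivative]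
    simp only [fullEgf, coeff_mk]
    push_cast
    ring

lemma one_sub_egf_strongTournament_mul :
    (1 - egf (count strongTournamentWeight)) * fullEgf (count tournamentWeight) = 1 := by
  rw [sub_mul, one_mul, egf_eq_fullEgf, fullEgf_mul, one_eq_fullEgf]
  ext n
  simp only [map_sub, fullEgf, coeff_mk]
  by_cases hn : n = 0
  · subst hn
    simp [count_tournament]
  · rw [← count_tournament_eq_sum hn, if_neg hn]
    simp

lemma add_choose_two (k m : ℕ) : (k + m).choose 2 = k.choose 2 + m.choose 2 + k * m := by
  induction m with
  | zero => simp
  | succ m ih =>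
    rw [← add_assoc, Nat.choose_succ_succ' (k + m) 1, Nat.choose_succ_succ' m 1, ih]
    simp only [Nat.choose_one_right, Nat.reduceAdd]
    ring

lemma fullEgf_sign_div_mul :
    fullEgf (fun k => count signWeight k / 2 ^ k.choose 2) * fullEgf (count tournamentWeight) =
      1 := by
  rw [fullEgf_mul, one_eq_fullEgf]
  congr 1
  funext n
  -- Dividing the recursion by 2^C(n,2) leaves its right side unchanged, because C(0,2) = 0. On the
  -- left, with n = k + m, the identities C(n,2) = C(k,2) + C(m,2) + km and m(m-1) = 2 C(m,2) leave
  -- b_k / 2^C(k,2) times 2^C(m,2).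
  have h2 : (if n = 0 then 1 else 0 : ℚ) = (if n = 0 then 1 else 0) / 2 ^ n.choose 2 := by
    by_cases hn : n = 0 <;> simp [hn]
  rw [h2, ← sum_count_sign, Finset.sum_div]
  refine Finset.sum_congr rfl fun k hk => ?_
  obtain ⟨m, rfl⟩ := Nat.exists_eq_add_of_le (Nat.lt_succ_iff.1 (mem_range.1 hk))
  have hm : m * (m - 1) = m.choose 2 + m.choose 2 := by
    rw [Nat.choose_two_right, ← two_mul, Nat.mul_div_cancel' (Nat.even_mul_pred_self m).two_dvd]
  rw [count_tournament, add_tsub_cancel_left, hm, add_choose_two, pow_add, pow_add, pow_add]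
  field_simp

lemma one_sub_egf_eq_fullEgf_sign :
    1 - egf (fun n => 2 ^ n.choose 2 * (t n : ℚ)) = fullEgf (count signWeight) := by
  have h : 1 - egf (count strongTournamentWeight) =
      fullEgf fun k => count signWeight k / 2 ^ k.choose 2 := by
    have hG : fullEgf (count tournamentWeight) ≠ 0 := right_ne_zero_of_mul_eq_one
      one_sub_egf_strongTournament_mul
    exact mul_right_cancel₀ hG (one_sub_egf_strongTournament_mul.trans fullEgf_sign_div_mul.symm)
  -- Coefficientwise, the goal is `h` with its n-th coefficient multiplied by 2^C(n,2).
  ext n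
  have hn := congrArg (coeff n) h
  simp only [egf, fullEgf, map_sub, coeff_mk, coeff_one, t_eq_count] at hn ⊢
  rcases n with _ | n
  · simpa using hn
  · simp only [Nat.add_eq_zero_iff, one_ne_zero, and_false, if_false, zero_sub] at hn ⊢
    have := Nat.cast_ne_zero (R := ℚ).2 (Nat.factorial_ne_zero (n + 1))
    field_simp at hn ⊢
    linarith

lemma X_mul_derivative_fullEgf_sign :
    X * d⁄dX ℚ (fullEgf (count signWeight)) =
      -(X * d⁄dX ℚ (egf (count strongWeight))) * fullEgf (count signWeight) := by
  rw [egf_eq_fullEgf, neg_mul, X_mul_derivative_fullEgf, X_mul_derivative_fullEgf, fullEgf_mul]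
  ext n
  simp only [map_neg, fullEgf, coeff_mk, mul_count_sign, neg_div]
  congr 2
  refine Finset.sum_congr rfl fun k _ => ?_
  -- `egf` drops the term at 0 whereas the count of strong relations keeps it; the factor `k` from
  -- the derivative removes the difference.
  by_cases hk : k = 0 <;> simp [hk]

lemma exp_subst_mul_fullEgf_sign :
    (PowerSeries.exp ℚ).subst (egf (count strongWeight)) * fullEgf (count signWeight) = 1 := by
  have h0 : constantCoeff (egf (count strongWeight)) = 0 := by
    simp [egf, ← coeff_zero_eq_constantCoeff_apply]
  have hS := HasSubst.of_constantCoeff_zero' h0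
  have hB := mul_left_cancel₀ X_ne_zero (X_mul_derivative_fullEgf_sign.trans
    (show _ = X * (-(d⁄dX ℚ (egf (count strongWeight))) * fullEgf (count signWeight)) by ring))
  -- With B' = -S' B, the derivative of exp(S) B is zero, so only the constant term remains to be
  -- compared.
  refine derivative.ext ?_ ?_
  · rw [Derivation.leibniz, hB, derivative_subst hS, derivative_exp, derivative_one, smul_eq_mul,
      smul_eq_mul]
    ring
  · have he : constantCoeff ((PowerSeries.exp ℚ).subst (egf (count strongWeight))) = 1 := by
      have h1 : (PowerSeries.exp ℚ) = 1 + (PowerSeries.exp ℚ - 1) := by ring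
      have h2 := constantCoeff_subst_eq_zero h0 (PowerSeries.exp ℚ - 1) (by simp)
      rw [h1, subst_add hS, map_add]
      have h3 : (1 : PowerSeries ℚ).subst (egf (count strongWeight)) = (1 : PowerSeries ℚ) := by
        rw [← coe_substAlgHom hS, map_one]
      rw [h3, map_one]
      exact add_eq_left.2 h2
    have hb : constantCoeff (fullEgf (count signWeight)) = 1 := by
      rw [← one_sub_egf_eq_fullEgf_sign, ← coeff_zero_eq_constantCoeff_apply]
      simp [egf]
    rw [map_mul, he, hb, map_one, one_mul]

end Fourientation

theorem corollary3 :
    (∀ n : ℕ, Fourientation.t n =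
      Set.ncard {D : Digraph (Fin n) |
        Fourientation.IsTournament D ∧ Fourientation.StronglyConnected D}) ∧
    (∀ n : ℕ, Fourientation.s n =
      Set.ncard {D : Digraph (Fin n) |
        Fourientation.IsSimpleDigraph D ∧ Fourientation.StronglyConnected D}) ∧
    (1 - Fourientation.egf (fun n => 2 ^ (n.choose 2) * (Fourientation.t n : ℚ)))⁻¹ =
      (PowerSeries.exp ℚ).subst (Fourientation.egf (fun n => (Fourientation.s n : ℚ))) := by
  refine ⟨Fourientation.t_eq_ncard, Fourientation.s_eq_ncard, ?_⟩
  have h := Fourientation.exp_subst_mul_fullEgf_sign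
  rw [← funext Fourientation.s_eq_count, ← Fourientation.one_sub_egf_eq_fullEgf_sign] at h
  refine (PowerSeries.inv_eq_iff_mul_eq_one fun h0 => ?_).2 h
  have := congrArg PowerSeries.constantCoeff h
  rw [map_mul, h0, mul_zero, map_one] at this
  exact zero_ne_one this
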